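/- Let $N\ge 1$, let $\Omega\subset\mathbb{R}^N$ be a bounded domain with Lipschitz boundary, and let $\Gamma\subset\partial\Omega$ be relatively closed with $\mathcal{H}^{N-1}(\Gamma)>0$. Let $(F,\chi)$ be a facet in $\Omega$, that is, $F\subset\overline{\Omega}$ is compact and $\chi\in C^0(\Omega\setminus F;\{\pm1\})$, and assume that $F$ has Lipschitz boundary, with outer unit normal $\nu_F$. Put $\Gamma_F:=\partial F\cap\Gamma$. Let $X_2(F)$ be the set of vector fields $z\in L^\infty(F,\mathbb{R}^N)$ whose distributional divergence in the interior of $F$ belongs to $L^2(F)$. The normal trace $[z\cdot\nu_F]\in L^\infty(\partial F,\mathcal{H}^{N-1})$ of $z\in X_2(F)$ is defined by $$\int_F (\operatorname{div} z)\,\varphi\,dx+\int_F z\cdot\nabla\varphi\,dx=\int_{\partial F}[z\cdot\nu_F]\,\varphi\,d\mathcal{H}^{N-1}\qquad\text{for all }\varphi\in C^\infty(\mathbb{R}^N).$$ Let $CH(F,\Omega,\Gamma)$ (the Cahn–Hoffman vector fields) be the set of all $z\in X_2(F)$ such that $$\|z\|_\infty\le 1,\qquad [z\cdot\nu_F]=\gamma\chi\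 \text{ on }\partial F\cap\Omega,\qquad [z\cdot\nu_F]=0\ \text{ on }(F\cap\partial\Omega)\setminus\Gamma$$ (equalities $\mathcal{H}^{N-1}$-a.e.), where $\gamma\chi$ is the trace of $\chi$ taken from the complement of $F$. For $\tau>0$ and $z\in CH(F,\Omega,\Gamma)$ let $$I_\tau(z)=\int_F|\operatorname{div} z|^2\,dx+\frac1\tau\int_{\Gamma_F}|[z\cdot\nu_F]|^2\,d\mathcal{H}^{N-1}.$$ Let $z_*\in CH(F,\Omega,\Gamma)$ and let $\lambda_*,\mu_*\in\mathbb{R}$ be such that $\operatorname{div} z_*=\lambda_*$ a.e. on $F$, $[z_*\cdot\nu_F]=\mu_*$ $\mathcal{H}^{N-1}$-a.e. on $\Gamma_F$, and $\tau\lambda_*+\mu_*=0$. Then $z_*$ is a minimizer of $I_\tau$ over $CH(F,\Omega,\Gamma)$, i.e. $I_\tau(z_*)\le I_\tau(z)$ for all $z\in CH(F,\Omega,\Gamma)$. -/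

import Mathlib

open MeasureTheory Set Filter Topology
open scoped ENNReal NNReal ContDiff

noncomputable section

namespace CahnHoffman

/-- The `(N-1)`-dimensional Hausdorff measure `ℋ^{N-1}` on `ℝ^N`, with the usual normalization
(it is the surface measure on hypersurfaces; counting measure if `N = 1`). -/
def surfaceMeasure (N : ℕ) : Measure (EuclideanSpace ℝ (Fin N)) :=
  Measure.euclideanHausdorffMeasure (N - 1)

/-- `A` has Lipschitz boundary: near every boundary point, in a suitable direction `e`, the set `A`
is the part of space below the graph of a Lipschitz function `f` of the variables orthogonal to
`e`. The formulation covers open sets as well as closed ones. -/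
def HasLipschitzBoundary {N : ℕ} (A : Set (EuclideanSpace ℝ (Fin N))) : Prop :=
  ∀ x ∈ frontier A, ∃ (e : EuclideanSpace ℝ (Fin N)) (f : EuclideanSpace ℝ (Fin N) → ℝ)
    (K : ℝ≥0) (r : ℝ),
    ‖e‖ = 1 ∧ LipschitzWith K f ∧ (∀ (y : EuclideanSpace ℝ (Fin N)) (t : ℝ), f (y + t • e) = f y) ∧
    0 < r ∧ ∀ y ∈ Metric.ball x r,
      (y ∈ interior A ↔ inner ℝ y e < f y) ∧ (y ∈ closure A ↔ inner ℝ y e ≤ f y)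

/-- Bounded domains with Lipschitz boundary. -/
structure IsLipschitzDomain {N : ℕ} (Ω : Set (EuclideanSpace ℝ (Fin N))) : Prop where
  isOpen : IsOpen Ω
  isConnected : IsConnected Ω
  isBounded : Bornology.IsBounded Ω
  lipschitz : HasLipschitzBoundary Ω

/-- `Γ` is a relatively closed subset of `∂Ω` of positive `ℋ^{N-1}` measure. -/
structure IsBoundaryPart {N : ℕ} (Ω Γ : Set (EuclideanSpace ℝ (Fin N))) : Prop where
  subset : Γ ⊆ frontier Ω
  isClosed : IsClosed Γ
  measure_pos : 0 < surfaceMeasure N Γ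

/-- `(F, χ)` is a facet in `Ω`: `F` is a compact subset of the closure of `Ω`, and the direction
`χ` is a continuous function on `Ω \ F` with values in `{1, -1}` (the values of `χ` elsewhere are
irrelevant). -/
structure IsFacet {N : ℕ} (Ω F : Set (EuclideanSpace ℝ (Fin N)))
    (χ : EuclideanSpace ℝ (Fin N) → ℝ) : Prop where
  isCompact : IsCompact F
  subset : F ⊆ closure Ω
  continuousOn : ContinuousOn χ (Ω \ F)
  values : ∀ x ∈ Ω \ F, χ x = 1 ∨ χ x = -1

/-- `d ∈ L²(F)` is the distributional divergence of `z` in the interior of `F`. -/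
def IsWeakDiv {N : ℕ} (F : Set (EuclideanSpace ℝ (Fin N)))
    (z : EuclideanSpace ℝ (Fin N) → EuclideanSpace ℝ (Fin N))
    (d : EuclideanSpace ℝ (Fin N) → ℝ) : Prop :=
  MemLp d 2 (volume.restrict F) ∧
  ∀ φ : EuclideanSpace ℝ (Fin N) → ℝ, ContDiff ℝ ∞ φ → HasCompactSupport φ →
    tsupport φ ⊆ interior F →
    ∫ x in F, fderiv ℝ φ x (z x) = - ∫ x in F, d x * φ x

/-- The space `X₂(F)` of bounded vector fields on `F` whose distributional divergence is a square
integrable function. -/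
def X2 {N : ℕ} (F : Set (EuclideanSpace ℝ (Fin N))) :
    Set (EuclideanSpace ℝ (Fin N) → EuclideanSpace ℝ (Fin N)) :=
  {z | MemLp z ∞ (volume.restrict F) ∧ ∃ d, IsWeakDiv F z d}

open Classical in
/-- `div z` on `F`, for `z ∈ X₂(F)` (determined up to a null set). -/
def weakDiv {N : ℕ} (F : Set (EuclideanSpace ℝ (Fin N)))
    (z : EuclideanSpace ℝ (Fin N) → EuclideanSpace ℝ (Fin N)) : EuclideanSpace ℝ (Fin N) → ℝ :=
  if h : ∃ d, IsWeakDiv F z d then h.choose else 0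

/-- `g ∈ L^∞(∂F, ℋ^{N-1})` is the weak normal trace `[z · ν_F]` of `z`, defined as usual
through the Gauss–Green formula
`∫_F (div z) φ dx + ∫_F z · ∇φ dx = ∫_{∂F} g φ dℋ^{N-1}` for all smooth `φ`. -/
def IsNormalTrace {N : ℕ} (F : Set (EuclideanSpace ℝ (Fin N)))
    (z : EuclideanSpace ℝ (Fin N) → EuclideanSpace ℝ (Fin N))
    (g : EuclideanSpace ℝ (Fin N) → ℝ) : Prop :=
  MemLp g ∞ ((surfaceMeasure N).restrict (frontier F)) ∧
  ∀ φ : EuclideanSpace ℝ (Fin N) → ℝ, ContDiff ℝ ∞ φ →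
    (∫ x in F, weakDiv F z x * φ x) + (∫ x in F, fderiv ℝ φ x (z x))
      = ∫ x in frontier F, g x * φ x ∂(surfaceMeasure N)

open Classical in
/-- The normal trace `[z · ν_F]` on `∂F` (determined up to an `ℋ^{N-1}`-null set). -/
def normalTrace {N : ℕ} (F : Set (EuclideanSpace ℝ (Fin N)))
    (z : EuclideanSpace ℝ (Fin N) → EuclideanSpace ℝ (Fin N)) : EuclideanSpace ℝ (Fin N) → ℝ :=
  if h : ∃ g, IsNormalTrace F z g then h.choose else 0

/-- The set `CH(F, Ω, Γ)` of Cahn–Hoffman vector fields of the facet `(F, χ)`. The condition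
`[z · ν_F] = γχ` on `∂F ∩ Ω` says that the normal trace at `x` is the limit at `x` of `χ`, taken
from the complement of `F`. -/
structure IsCahnHoffman {N : ℕ} (Ω Γ F : Set (EuclideanSpace ℝ (Fin N)))
    (χ : EuclideanSpace ℝ (Fin N) → ℝ)
    (z : EuclideanSpace ℝ (Fin N) → EuclideanSpace ℝ (Fin N)) : Prop where
  mem_X2 : z ∈ X2 F
  exists_trace : ∃ g, IsNormalTrace F z g
  norm_le_one : ∀ᵐ x ∂(volume.restrict F), ‖z x‖ ≤ 1
  trace_interior : ∀ᵐ x ∂((surfaceMeasure N).restrict (frontier F ∩ Ω)),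
    Tendsto χ (𝓝[Ω \ F] x) (𝓝 (normalTrace F z x))
  trace_boundary : ∀ᵐ x ∂((surfaceMeasure N).restrict ((F ∩ frontier Ω) \ Γ)),
    normalTrace F z x = 0

/-- `CH(F, Ω, Γ)` as a set of vector fields. -/
def CH {N : ℕ} (Ω Γ F : Set (EuclideanSpace ℝ (Fin N))) (χ : EuclideanSpace ℝ (Fin N) → ℝ) :
    Set (EuclideanSpace ℝ (Fin N) → EuclideanSpace ℝ (Fin N)) :=
  {z | IsCahnHoffman Ω Γ F χ z}

/-- The functional
`I_τ(z) = ∫_F |div z|² dx + (1/τ) ∫_{Γ_F} |[z · ν]|² dℋ^{N-1}`, where `Γ_F = ∂F ∩ Γ`. -/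
def functionalI {N : ℕ} (Γ F : Set (EuclideanSpace ℝ (Fin N))) (τ : ℝ)
    (z : EuclideanSpace ℝ (Fin N) → EuclideanSpace ℝ (Fin N)) : ℝ :=
  (∫ x in F, (weakDiv F z x) ^ 2)
    + (1 / τ) * ∫ x in frontier F ∩ Γ, (normalTrace F z x) ^ 2 ∂(surfaceMeasure N)

end CahnHoffman

end

open CahnHoffman

namespace CahnHoffman

/-! The functional is convex, so stationarity suffices. By `integral_sq_tangent_le`, for each
competitor `w`, `I_τ(w) - I_τ(z)` is at least `2λ ∫_F (div w - div z) + (2μ/τ) ∫_{Γ_F} ([w·ν] -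
[z·ν])`. The two integrals are equal: test Gauss–Green with `φ = 1`, and note that the traces agree
on `∂F \ Γ`, where the constraints prescribe them (`normalTrace_ae_eq`). The sum thus carries the
factor `2(λ + μ/τ) = 0`. Bounded traces are integrable because a compact Lipschitz boundary has
finite surface measure, being locally a Lipschitz image of a ball in a hyperplane. -/

/-- Lipschitz maps increase the normalized Hausdorff measure at most by a finite factor. -/
theorem euclideanHausdorffMeasure_image_le_of_lipschitzWith {X Y : Type*}
    [EMetricSpace X] [MeasurableSpace X] [BorelSpace X]
    [EMetricSpace Y] [MeasurableSpace Y] [BorelSpace Y]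
    {K : ℝ≥0} {f : X → Y} (hf : LipschitzWith K f) (d : ℕ) (s : Set X) :
    (Measure.euclideanHausdorffMeasure d : Measure Y) (f '' s)
      ≤ (K : ℝ≥0∞) ^ d * (Measure.euclideanHausdorffMeasure d : Measure X) s := by
  simp only [Measure.euclideanHausdorffMeasure_def, Measure.smul_apply, ENNReal.smul_def,
    smul_eq_mul]
  calc _ ≤ _ := mul_le_mul_right (hf.hausdorffMeasure_image_le (Nat.cast_nonneg d) s) _
    _ = _ := by rw [ENNReal.rpow_natCast]; ring

/-- A bounded piece of a Lipschitz graph has finite surface measure. -/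
theorem surfaceMeasure_graph_lt_top {N : ℕ} {e : EuclideanSpace ℝ (Fin N)}
    {f : EuclideanSpace ℝ (Fin N) → ℝ} {K : ℝ≥0} (he : ‖e‖ = 1) (hf : LipschitzWith K f)
    (hfe : ∀ (y : EuclideanSpace ℝ (Fin N)) (t : ℝ), f (y + t • e) = f y) (R : ℝ) :
    surfaceMeasure N {y | ‖y‖ ≤ R ∧ inner ℝ y e = f y} < ⊤ := by
  have he0 : e ≠ 0 := by rintro rfl; simp at he
  let W := (ℝ ∙ e)ᗮ
  have hrank : Module.finrank ℝ W = N - 1 := by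
    have h := (ℝ ∙ e).finrank_add_finrank_orthogonal
    rw [finrank_span_singleton he0, finrank_euclideanSpace_fin] at h
    change 1 + Module.finrank ℝ W = N at h
    omega
  -- The graph is parametrized over the hyperplane orthogonal to `e`; `f` is constant along `e`, so
  -- its values on `W` determine it.
  let G : W → EuclideanSpace ℝ (Fin N) := fun w => (w : EuclideanSpace ℝ (Fin N)) + f w • e
  have hG : LipschitzWith (1 + K) G := by
    refine (LipschitzWith.subtype_val _).add (LipschitzWith.of_dist_le_mul fun w v => ?_)
    rw [dist_eq_norm, ← sub_smul, norm_smul, he, mul_one]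
    exact hf.dist_le_mul w v
  have hsub : {y | ‖y‖ ≤ R ∧ inner ℝ y e = f y} ⊆ G '' Metric.closedBall 0 R := by
    rintro y ⟨hy, hye⟩
    have horth : y + (-inner ℝ y e) • e ∈ W := by
      rw [Submodule.mem_orthogonal_singleton_iff_inner_left, inner_add_left, inner_smul_left]
      simp [he]
    refine ⟨⟨_, horth⟩, ?_, ?_⟩
    · have hle : ‖y + (-inner ℝ y e) • e‖ ≤ ‖y‖ := by
        have hpyth := norm_add_sq_eq_norm_sq_add_norm_sq_real
          (x := y + (-inner ℝ y e) • e) (y := inner ℝ y e • e) (by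
            rw [inner_smul_right,
              (Submodule.mem_orthogonal_singleton_iff_inner_left).1 horth, mul_zero])
        rw [neg_smul, neg_add_cancel_right] at hpyth
        rw [neg_smul]
        nlinarith [norm_nonneg y, norm_nonneg (y + -(inner ℝ y e • e)),
          mul_self_nonneg ‖inner ℝ y e • e‖]
      simpa using hle.trans hy
    · simp only [G]
      rw [hfe, ← hye, neg_smul, neg_add_cancel_right]
  have hball : (Measure.euclideanHausdorffMeasure (N - 1) : Measure W)
      (Metric.closedBall 0 R) < ⊤ := by
    -- In dimension `finrank W`, the Hausdorff measure on `W` is finite on compact sets.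
    rw [← hrank]
    exact (isCompact_closedBall (0 : W) R).measure_lt_top
  refine (measure_mono hsub).trans_lt
    ((euclideanHausdorffMeasure_image_le_of_lipschitzWith hG (N - 1) _).trans_lt ?_)
  exact ENNReal.mul_lt_top (ENNReal.pow_lt_top ENNReal.coe_lt_top) hball

/-- A compact Lipschitz boundary has finite surface measure. -/
theorem HasLipschitzBoundary.surfaceMeasure_frontier_lt_top {N : ℕ}
    {A : Set (EuclideanSpace ℝ (Fin N))} (hA : HasLipschitzBoundary A)
    (hc : IsCompact (frontier A)) : surfaceMeasure N (frontier A) < ⊤ := by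
  refine hc.measure_lt_top_of_nhdsWithin fun x hx => ?_
  obtain ⟨e, f, K, r, he, hf, hfe, hr, h⟩ := hA x hx
  refine ⟨Metric.ball x r ∩ frontier A, inter_mem (mem_nhdsWithin_of_mem_nhds
    (Metric.ball_mem_nhds x hr)) self_mem_nhdsWithin, ?_⟩
  refine (measure_mono ?_).trans_lt (surfaceMeasure_graph_lt_top he hf hfe (‖x‖ + r))
  rintro y ⟨hy, hyc, hyi⟩
  refine ⟨?_, le_antisymm ((h y hy).2.1 hyc) (not_lt.1 fun hlt => hyi ((h y hy).1.2 hlt))⟩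
  have hyx : ‖y - x‖ < r := mem_ball_iff_norm.1 hy
  linarith [norm_le_norm_add_norm_sub' y x]

theorem weakDiv_spec {N : ℕ} {F : Set (EuclideanSpace ℝ (Fin N))}
    {z : EuclideanSpace ℝ (Fin N) → EuclideanSpace ℝ (Fin N)} (hz : z ∈ X2 F) :
    IsWeakDiv F z (weakDiv F z) := by
  rw [weakDiv, dif_pos hz.2]
  exact hz.2.choose_spec

theorem normalTrace_spec {N : ℕ} {F : Set (EuclideanSpace ℝ (Fin N))}
    {z : EuclideanSpace ℝ (Fin N) → EuclideanSpace ℝ (Fin N)} (hz : ∃ g, IsNormalTrace F z g) :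
    IsNormalTrace F z (normalTrace F z) := by
  rw [normalTrace, dif_pos hz]
  exact hz.choose_spec

/-- The divergence theorem: the Gauss–Green formula tested with the constant function `1`. -/
theorem IsNormalTrace.integral_weakDiv {N : ℕ} {F : Set (EuclideanSpace ℝ (Fin N))}
    {z : EuclideanSpace ℝ (Fin N) → EuclideanSpace ℝ (Fin N)}
    {g : EuclideanSpace ℝ (Fin N) → ℝ} (h : IsNormalTrace F z g) :
    ∫ x in F, weakDiv F z x = ∫ x in frontier F, g x ∂(surfaceMeasure N) := by
  simpa using h.2 (fun _ => 1) contDiff_const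

/-- The normal traces of two Cahn–Hoffman vector fields agree away from `Γ`. -/
theorem normalTrace_ae_eq {N : ℕ} {Ω Γ F : Set (EuclideanSpace ℝ (Fin N))}
    {χ : EuclideanSpace ℝ (Fin N) → ℝ}
    {z w : EuclideanSpace ℝ (Fin N) → EuclideanSpace ℝ (Fin N)}
    (hΩ : IsOpen Ω) (hF : IsFacet Ω F χ) (hz : z ∈ CH Ω Γ F χ) (hw : w ∈ CH Ω Γ F χ) :
    ∀ᵐ x ∂((surfaceMeasure N).restrict (frontier F \ Γ)),
      normalTrace F w x = normalTrace F z x := by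
  have hclosed : IsClosed F := hF.isCompact.isClosed
  have hcover : frontier F \ Γ ⊆ (frontier F ∩ Ω) ∪ ((F ∩ frontier Ω) \ Γ) := by
    rintro x ⟨hx, hxΓ⟩
    have hxF : x ∈ F := hclosed.frontier_subset hx
    by_cases hxΩ : x ∈ Ω
    · exact Or.inl ⟨hx, hxΩ⟩
    · exact Or.inr ⟨⟨hxF, hF.subset hxF, fun h => hxΩ (interior_subset h)⟩, hxΓ⟩
  refine ae_restrict_of_ae_restrict_of_subset hcover ((ae_restrict_union_iff _ _ _).2 ⟨?_, ?_⟩)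
  · filter_upwards [hz.trace_interior, hw.trace_interior,
      ae_restrict_mem (isClosed_frontier.measurableSet.inter hΩ.measurableSet)] with x hzx hwx hx
    -- Limits along `𝓝[Ω \ F] x` are unique only if this filter is nontrivial, that is, if `x` is a
    -- limit of points of `Ω \ F`.
    have hxc : x ∈ closure (Ω \ F) := by
      rw [sdiff_eq]
      refine hΩ.inter_closure ⟨hx.2, ?_⟩
      rw [closure_compl]
      exact hx.1.2
    have : (𝓝[Ω \ F] x).NeBot := mem_closure_iff_nhdsWithin_neBot.1 hxc
    exact tendsto_nhds_unique hwx hzx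
  · filter_upwards [hz.trace_boundary, hw.trace_boundary] with x hzx hwx
    rw [hzx, hwx]

/-- The tangent line inequality for the square, integrated. -/
theorem integral_sq_tangent_le {α : Type*} [MeasurableSpace α] {μ : Measure α}
    [IsFiniteMeasure μ] {f g : α → ℝ} {c : ℝ} (hf : MemLp f 2 μ) (hg : MemLp g 2 μ)
    (hgc : ∀ᵐ x ∂μ, g x = c) :
    ∫ x, (g x) ^ 2 ∂μ + 2 * c * (∫ x, f x ∂μ - ∫ x, g x ∂μ) ≤ ∫ x, (f x) ^ 2 ∂μ := by
  have hf1 : Integrable f μ := hf.integrable one_le_two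
  have hg1 : Integrable g μ := hg.integrable one_le_two
  have hint : Integrable (fun x => 2 * c * (f x - g x)) μ := (hf1.sub hg1).const_mul _
  rw [← integral_sub hf1 hg1, ← integral_const_mul, ← integral_add hg.integrable_sq hint]
  refine integral_mono_ae (hg.integrable_sq.add hint) hf.integrable_sq ?_
  filter_upwards [hgc] with x hx
  simp only [hx]
  -- `f² - c² - 2c(f - c) = (f - c)²`.
  nlinarith [sq_nonneg (f x - c)]

end CahnHoffman

theorem mainTheorem11 {N : ℕ} (hN : 1 ≤ N)
    (Ω Γ F : Set (EuclideanSpace ℝ (Fin N))) (χ : EuclideanSpace ℝ (Fin N) → ℝ)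
    (hΩ : IsLipschitzDomain Ω) (hΓ : IsBoundaryPart Ω Γ)
    (hF : IsFacet Ω F χ) (hFlip : HasLipschitzBoundary F)
    (τ : ℝ) (hτ : 0 < τ)
    (z : EuclideanSpace ℝ (Fin N) → EuclideanSpace ℝ (Fin N)) (hz : z ∈ CH Ω Γ F χ)
    (lam mu : ℝ)
    (hdiv : ∀ᵐ x ∂(volume.restrict F), weakDiv F z x = lam)
    (htrace : ∀ᵐ x ∂((surfaceMeasure N).restrict (frontier F ∩ Γ)), normalTrace F z x = mu)
    (hbal : τ * lam + mu = 0) :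
    IsMinOn (functionalI Γ F τ) (CH Ω Γ F χ) z := by
  intro w hw
  change functionalI Γ F τ z ≤ functionalI Γ F τ w
  have hfin : surfaceMeasure N (frontier F) < ⊤ := hFlip.surfaceMeasure_frontier_lt_top
    (hF.isCompact.of_isClosed_subset isClosed_frontier hF.isCompact.isClosed.frontier_subset)
  have : IsFiniteMeasure (volume.restrict F) :=
    isFiniteMeasure_restrict.2 hF.isCompact.measure_lt_top.ne
  have : IsFiniteMeasure ((surfaceMeasure N).restrict (frontier F)) :=
    isFiniteMeasure_restrict.2 hfin.ne
  have : IsFiniteMeasure ((surfaceMeasure N).restrict (frontier F ∩ Γ)) :=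
    isFiniteMeasure_restrict.2 ((measure_mono inter_subset_left).trans_lt hfin).ne
  have hzt := normalTrace_spec hz.exists_trace
  have hwt := normalTrace_spec hw.exists_trace
  have hle : (surfaceMeasure N).restrict (frontier F ∩ Γ)
      ≤ (surfaceMeasure N).restrict (frontier F) :=
    Measure.restrict_mono_set _ inter_subset_left
  have hvol := integral_sq_tangent_le (weakDiv_spec hw.mem_X2).1 (weakDiv_spec hz.mem_X2).1 hdiv
  have hsurf := integral_sq_tangent_le ((hwt.1.mono_measure hle).mono_exponent le_top)
    ((hzt.1.mono_measure hle).mono_exponent le_top) htrace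
  have hflux : (∫ x in F, weakDiv F w x) - ∫ x in F, weakDiv F z x
      = (∫ x in frontier F ∩ Γ, normalTrace F w x ∂(surfaceMeasure N))
        - ∫ x in frontier F ∩ Γ, normalTrace F z x ∂(surfaceMeasure N) := by
    -- Total fluxes are split along `Γ`; the parts over `∂F \ Γ` cancel.
    rw [hwt.integral_weakDiv, hzt.integral_weakDiv,
      ← integral_inter_add_sdiff hΓ.isClosed.measurableSet (hwt.1.integrable le_top),
      ← integral_inter_add_sdiff hΓ.isClosed.measurableSet (hzt.1.integrable le_top),
      integral_congr_ae (normalTrace_ae_eq hΩ.isOpen hF hz hw)]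
    ring
  rw [hflux] at hvol
  have hmu : mu = -(τ * lam) := by linarith
  have hsurf' := mul_le_mul_of_nonneg_left hsurf (one_div_pos.2 hτ).le
  unfold functionalI
  rw [hmu] at hsurf'
  -- With `μ = -τλ`, the surface slope `2μ/τ` is exactly minus the volume slope `2λ`.
  have hcancel : ∀ t : ℝ, 1 / τ * (2 * -(τ * lam) * t) = -(2 * lam * t) := fun t => by
    field_simp
  rw [mul_add, hcancel] at hsurf'
  linarith
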